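/- Let $r\ge 1$ be an integer, and let $\eta=1$ if $r$ is odd and $\eta=0$ if $r$ is even. Let $h$ be a complex-valued function on the positive integers with $|h(d)|\ll d^{\alpha}$ for some real $\alpha\in\left[0,\frac{r+2-\eta}{2r-2+2\eta}\right)$, and let $f$ be the arithmetic function supported on $r$-th powers given by $f(d^r)=h(d)$ for every integer $d\ge 1$ and $f(n)=0$ if $n\geq 1$ is not an $r$-th power. Then the series $$C_f=\sum_{n=1}^{\infty}\frac{f(n)}{n(n+1)}$$ converges absolutely and, for all real $x\ge 1$, $$S_f(x):=\sum_{1\le n\le x} f\left(\left\lfloor \frac{x}{n}\right\rfloor\right)=C_f\,x+O\left(x^{\frac{2(1+\alpha)}{3r+\eta}}\right),$$ where $\lfloor\cdot\rfloor$ is the integer part and the implied constant does not depend on $x$ (it may depend on $r$, $\alpha$ and $f$). -/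

import Mathlib

open Filter Asymptotics

noncomputable section

/-- The parity indicator: `1` if `r` is odd and `0` if `r` is even. -/
def parityEta (r : ℕ) : ℝ := if Odd r then 1 else 0

/-- The arithmetic function `f` (on the positive integers) is supported on `r`-th powers, and
takes the value `h d` at `d ^ r`. The values `f 0` and `h 0` play no role. -/
def SupportedOnPowers (r : ℕ) (h f : ℕ → ℂ) : Prop :=
  (∀ d : ℕ, 1 ≤ d → f (d ^ r) = h d) ∧
    ∀ n : ℕ, 1 ≤ n → (∀ d : ℕ, n ≠ d ^ r) → f n = 0

/-- `S_f(x) = ∑_{1 ≤ n ≤ x} f(⌊x / n⌋)` for real `x`. -/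
def floorSum (f : ℕ → ℂ) (x : ℝ) : ℂ :=
  ∑ n ∈ Finset.Icc 1 ⌊x⌋₊, f ⌊x / (n : ℝ)⌋₊

/-- The term `f(n) / (n (n + 1))` of the series `C_f`, with `n = k + 1`, `k = 0, 1, 2, …`. -/
def mainTerm (f : ℕ → ℂ) (k : ℕ) : ℂ :=
  f (k + 1) / (((k : ℂ) + 1) * ((k : ℂ) + 2))

/-- `C_f = ∑_{n ≥ 1} f(n) / (n (n + 1))`. -/
def mainConst (f : ℕ → ℂ) : ℂ := ∑' k : ℕ, mainTerm f k

end

/-- The explicit antiderivative in `w` of `L (w - u) ^ j (b - w) ^ j w ^ (s - j - 1)`. -/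
theorem exists_integer_primitive (j s : ℕ) (hs : j + 1 ≤ s) :
    ∃ a : ℕ → ℕ → ℤ, ∀ u b w : ℝ,
      HasDerivAt (fun w : ℝ => ∑ i ∈ Finset.range (j + 1), ∑ l ∈ Finset.range (j + 1),
          (a i l : ℝ) * u ^ (j - i) * b ^ l * w ^ (s + i - l))
        (((s + j).factorial : ℝ) * ((w - u) ^ j * (b - w) ^ j * w ^ (s - j - 1))) w := by
  refine ⟨fun i l => (j.choose i : ℤ) * (j.choose l : ℤ) * (-1) ^ (j - i) * (-1) ^ (j - l) *
    (((s + j).factorial / (s + i - l) : ℕ) : ℤ), fun u b w => ?_⟩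
  have key : ((s + j).factorial : ℝ) * ((w - u) ^ j * (b - w) ^ j * w ^ (s - j - 1)) =
      ∑ i ∈ Finset.range (j + 1), ∑ l ∈ Finset.range (j + 1),
        (((j.choose i : ℤ) * (j.choose l : ℤ) * (-1) ^ (j - i) * (-1) ^ (j - l) *
          (((s + j).factorial / (s + i - l) : ℕ) : ℤ) : ℤ) : ℝ) * u ^ (j - i) * b ^ l *
          (((s + i - l : ℕ) : ℝ) * w ^ (s + i - l - 1)) := by
    have e1 : (w - u) ^ j = ∑ i ∈ Finset.range (j + 1), w ^ i * (-u) ^ (j - i) * (j.choose i) := by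
      rw [sub_eq_add_neg, add_pow]
    have e2 : (b - w) ^ j = ∑ l ∈ Finset.range (j + 1), b ^ l * (-w) ^ (j - l) * (j.choose l) := by
      rw [sub_eq_add_neg, add_pow]
    rw [e1, e2, Finset.sum_mul_sum, Finset.sum_mul, Finset.mul_sum]
    refine Finset.sum_congr rfl fun i hi => ?_
    rw [Finset.sum_mul, Finset.mul_sum]
    refine Finset.sum_congr rfl fun l hl => ?_
    simp only [Finset.mem_range] at hi hl
    have hd : (s + i - l) ∣ (s + j).factorial := Nat.dvd_factorial (by omega) (by omega)
    have hd' : (((s + j).factorial / (s + i - l) : ℕ) : ℝ) * ((s + i - l : ℕ) : ℝ) =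
        ((s + j).factorial : ℝ) := by
      exact_mod_cast Nat.div_mul_cancel hd
    have hw : w ^ (s + i - l - 1) = w ^ i * w ^ (j - l) * w ^ (s - j - 1) := by
      rw [← pow_add, ← pow_add]; congr 1; omega
    rw [← hd', hw, neg_pow u, neg_pow w]
    simp only [Int.cast_mul, Int.cast_natCast, Int.cast_pow, Int.cast_neg, Int.cast_one]
    ring
  rw [key]
  refine HasDerivAt.fun_sum fun i _ => HasDerivAt.fun_sum fun l _ => ?_
  exact (hasDerivAt_pow (s + i - l) w).const_mul _

theorem integral_beta_bounds (j m : ℕ) (u b : ℝ) (hu : 0 ≤ u) (hub : u ≤ b) :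
    u ^ m * ((b - u) / 3) ^ (2 * j + 1) ≤ ∫ w in u..b, (w - u) ^ j * (b - w) ^ j * w ^ m ∧
      ∫ w in u..b, (w - u) ^ j * (b - w) ^ j * w ^ m ≤ (b - u) ^ (2 * j + 1) * b ^ m := by
  have hint : ∀ p q : ℝ, IntervalIntegrable (fun w : ℝ => (w - u) ^ j * (b - w) ^ j * w ^ m)
      MeasureTheory.volume p q := fun p q => Continuous.intervalIntegrable (by fun_prop) _ _
  constructor
  · have h1 : ∫ w in (u + (b - u) / 3)..(b - (b - u) / 3), (w - u) ^ j * (b - w) ^ j * w ^ m ≤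
        ∫ w in u..b, (w - u) ^ j * (b - w) ^ j * w ^ m := by
      refine intervalIntegral.integral_mono_interval (by linarith) (by linarith) (by linarith) ?_
        (hint _ _)
      filter_upwards [MeasureTheory.ae_restrict_mem measurableSet_Ioc] with w hw
      have := hw.1
      have := hw.2
      have h3 : 0 ≤ w - u := by linarith
      have h4 : 0 ≤ b - w := by linarith
      have h5 : 0 ≤ w := by linarith
      simp only [Pi.zero_apply]
      positivity
    have h2 : ∫ _ in (u + (b - u) / 3)..(b - (b - u) / 3), u ^ m * ((b - u) / 3) ^ (2 * j) ≤
        ∫ w in (u + (b - u) / 3)..(b - (b - u) / 3), (w - u) ^ j * (b - w) ^ j * w ^ m := by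
      refine intervalIntegral.integral_mono_on (by linarith) (by simp) (hint _ _) ?_
      intro w hw
      have := hw.1
      have := hw.2
      have h0 : 0 ≤ (b - u) / 3 := by linarith
      have e : u ^ m * ((b - u) / 3) ^ (2 * j) =
          ((b - u) / 3) ^ j * ((b - u) / 3) ^ j * u ^ m := by ring
      rw [e]
      have h3 : (b - u) / 3 ≤ w - u := by linarith
      have h4 : (b - u) / 3 ≤ b - w := by linarith
      have h5 : u ≤ w := by linarith
      have h6 : 0 ≤ w - u := h0.trans h3
      have h7 : 0 ≤ b - w := h0.trans h4
      gcongr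
    rw [intervalIntegral.integral_const, smul_eq_mul] at h2
    calc _ = (b - (b - u) / 3 - (u + (b - u) / 3)) * (u ^ m * ((b - u) / 3) ^ (2 * j)) := by ring
      _ ≤ _ := h2.trans h1
  · have h2 : ∫ w in u..b, (w - u) ^ j * (b - w) ^ j * w ^ m ≤
        ∫ _ in u..b, (b - u) ^ (2 * j) * b ^ m := by
      refine intervalIntegral.integral_mono_on hub (hint _ _) (by simp) ?_
      intro w hw
      have := hw.1
      have := hw.2
      have e : (b - u) ^ (2 * j) * b ^ m = (b - u) ^ j * (b - u) ^ j * b ^ m := by ring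
      rw [e]
      have h6 : 0 ≤ w - u := by linarith
      have h7 : 0 ≤ b - w := by linarith
      have h8 : 0 ≤ b - u := by linarith
      have h9 : 0 ≤ w := by linarith
      gcongr
    rw [intervalIntegral.integral_const, smul_eq_mul] at h2
    exact h2.trans (le_of_eq (by ring))

/-- Integral binary forms `P`, `Q` of degree `j` for which `b ^ s P - u ^ s Q` vanishes to order
`2 j + 1` along `u = b` (Padé approximation of `t ↦ t ^ s` at `1`). -/
theorem exists_pade_forms (j s : ℕ) (hs : j + 1 ≤ s) :
    ∃ L B : ℝ, 0 < L ∧ 0 < B ∧ ∀ u b : ℕ, u ≤ b → ∃ P Q : ℤ,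
      |(P : ℝ)| ≤ B * (b : ℝ) ^ j ∧ |(Q : ℝ)| ≤ B * (b : ℝ) ^ j ∧
      L * ((u : ℝ) ^ (s - j - 1) * (((b : ℝ) - u) / 3) ^ (2 * j + 1)) ≤
        (b : ℝ) ^ s * P - (u : ℝ) ^ s * Q ∧
      (b : ℝ) ^ s * P - (u : ℝ) ^ s * Q ≤
        L * (((b : ℝ) - u) ^ (2 * j + 1) * (b : ℝ) ^ (s - j - 1)) := by
  obtain ⟨a, ha⟩ := exists_integer_primitive j s hs
  refine ⟨(s + j).factorial, 1 + ∑ i ∈ Finset.range (j + 1), ∑ l ∈ Finset.range (j + 1),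
    |(a i l : ℝ)|, by positivity, by positivity, fun u b hub => ?_⟩
  have hubR : (u : ℝ) ≤ b := by exact_mod_cast hub
  refine ⟨∑ i ∈ Finset.range (j + 1), ∑ l ∈ Finset.range (j + 1), a i l * (u ^ (j - i) * b ^ i),
    ∑ i ∈ Finset.range (j + 1), ∑ l ∈ Finset.range (j + 1), a i l * (u ^ (j - l) * b ^ l),
    ?_, ?_, ?_⟩
  · push_cast
    have hb : (0 : ℝ) ≤ (b : ℝ) ^ j := by positivity
    refine (Finset.abs_sum_le_sum_abs _ _).trans ?_
    refine le_trans ?_ (mul_le_mul_of_nonneg_right (le_add_of_nonneg_left zero_le_one) hb)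
    rw [Finset.sum_mul]
    refine Finset.sum_le_sum fun i hi => (Finset.abs_sum_le_sum_abs _ _).trans ?_
    rw [Finset.sum_mul]
    refine Finset.sum_le_sum fun l hl => ?_
    rw [abs_mul]
    refine mul_le_mul_of_nonneg_left ?_ (abs_nonneg _)
    rw [abs_of_nonneg (by positivity)]
    simp only [Finset.mem_range] at hi
    calc (u : ℝ) ^ (j - i) * (b : ℝ) ^ i ≤ (b : ℝ) ^ (j - i) * (b : ℝ) ^ i := by gcongr
      _ = (b : ℝ) ^ j := by rw [← pow_add]; congr 1; omega
  · push_cast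
    have hb : (0 : ℝ) ≤ (b : ℝ) ^ j := by positivity
    refine (Finset.abs_sum_le_sum_abs _ _).trans ?_
    refine le_trans ?_ (mul_le_mul_of_nonneg_right (le_add_of_nonneg_left zero_le_one) hb)
    rw [Finset.sum_mul]
    refine Finset.sum_le_sum fun i hi => (Finset.abs_sum_le_sum_abs _ _).trans ?_
    rw [Finset.sum_mul]
    refine Finset.sum_le_sum fun l hl => ?_
    rw [abs_mul]
    refine mul_le_mul_of_nonneg_left ?_ (abs_nonneg _)
    rw [abs_of_nonneg (by positivity)]
    simp only [Finset.mem_range] at hl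
    calc (u : ℝ) ^ (j - l) * (b : ℝ) ^ l ≤ (b : ℝ) ^ (j - l) * (b : ℝ) ^ l := by gcongr
      _ = (b : ℝ) ^ j := by rw [← pow_add]; congr 1; omega
  · have hI := intervalIntegral.integral_eq_sub_of_hasDerivAt (a := (u : ℝ)) (b := (b : ℝ))
      (fun w _ => ha (u : ℝ) (b : ℝ) w) (Continuous.intervalIntegrable (by fun_prop) _ _)
    rw [intervalIntegral.integral_const_mul] at hI
    have hP : (b : ℝ) ^ s * ((∑ i ∈ Finset.range (j + 1), ∑ l ∈ Finset.range (j + 1),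
          a i l * (u ^ (j - i) * b ^ i) : ℤ) : ℝ) =
        ∑ i ∈ Finset.range (j + 1), ∑ l ∈ Finset.range (j + 1),
          (a i l : ℝ) * (u : ℝ) ^ (j - i) * (b : ℝ) ^ l * (b : ℝ) ^ (s + i - l) := by
      push_cast
      rw [Finset.mul_sum]
      refine Finset.sum_congr rfl fun i hi => ?_
      rw [Finset.mul_sum]
      refine Finset.sum_congr rfl fun l hl => ?_
      simp only [Finset.mem_range] at hi hl
      have : (b : ℝ) ^ l * (b : ℝ) ^ (s + i - l) = (b : ℝ) ^ s * (b : ℝ) ^ i := by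
        rw [← pow_add, ← pow_add]; congr 1; omega
      rw [mul_assoc _ ((b : ℝ) ^ l), this]
      ring
    have hQ : (u : ℝ) ^ s * ((∑ i ∈ Finset.range (j + 1), ∑ l ∈ Finset.range (j + 1),
          a i l * (u ^ (j - l) * b ^ l) : ℤ) : ℝ) =
        ∑ i ∈ Finset.range (j + 1), ∑ l ∈ Finset.range (j + 1),
          (a i l : ℝ) * (u : ℝ) ^ (j - i) * (b : ℝ) ^ l * (u : ℝ) ^ (s + i - l) := by
      push_cast
      rw [Finset.mul_sum]
      refine Finset.sum_congr rfl fun i hi => ?_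
      rw [Finset.mul_sum]
      refine Finset.sum_congr rfl fun l hl => ?_
      simp only [Finset.mem_range] at hi hl
      have : (u : ℝ) ^ (j - i) * (u : ℝ) ^ (s + i - l) = (u : ℝ) ^ s * (u : ℝ) ^ (j - l) := by
        rw [← pow_add, ← pow_add]; congr 1; omega
      calc _ = (a i l : ℝ) * (b : ℝ) ^ l * ((u : ℝ) ^ s * (u : ℝ) ^ (j - l)) := by ring
        _ = _ := by rw [← this]; ring
    rw [hP, hQ, ← hI]
    obtain ⟨hl, hr⟩ := integral_beta_bounds j (s - j - 1) (u : ℝ) b (by positivity) hubR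
    exact ⟨by gcongr, by gcongr⟩

/-- Some `n` satisfies `⌊x / n⌋ = d ^ s`. -/
def FloorHit (s : ℕ) (x : ℝ) (d : ℕ) : Prop :=
  ∃ n : ℕ, (n : ℝ) * (d : ℝ) ^ s ≤ x ∧ x < n * ((d : ℝ) ^ s + 1)

theorem FloorHit.pow_le {s d : ℕ} {x : ℝ} (hx : 0 ≤ x) (h : FloorHit s x d) :
    (d : ℝ) ^ s ≤ x := by
  obtain ⟨n, h1, h2⟩ := h
  rcases Nat.eq_zero_or_pos n with rfl | hn
  · simp at h2; linarith
  · have : (1 : ℝ) ≤ n := by exact_mod_cast hn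
    exact le_trans (le_mul_of_one_le_left (by positivity) this) h1

theorem FloorHit.gap (j s : ℕ) (hs : 2 * j + 1 ≤ s) :
    ∃ (A : ℕ) (K C : ℝ), 1 ≤ A ∧ 0 < K ∧ 0 < C ∧ ∀ (x : ℝ) (u b : ℕ), 1 ≤ x → 1 ≤ u →
      FloorHit s x u → FloorHit s x b → K * x ≤ (u : ℝ) ^ (2 * s - j) → u + A ≤ b →
      (b : ℝ) ^ (s + j + 1) ≤ C * x * ((b : ℝ) - u) ^ (2 * j + 1) := by
  obtain ⟨L, B, hL, hB, hPQ⟩ := exists_pade_forms j s (by omega)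
  obtain ⟨A₀, hA₀⟩ := exists_nat_gt (3 * (2 * B * 2 ^ (j + s)) / L)
  refine ⟨max 3 A₀, 4 * B * 2 ^ j, 2 ^ (s + 1) * L + 2 ^ (2 * j + 1), by simp, by positivity,
    by positivity, fun x u b hx hu hitu hitb hK hA => ?_⟩
  have hu1 : (1 : ℝ) ≤ u := by exact_mod_cast hu
  have hub : u ≤ b := by omega
  have hubR : (u : ℝ) ≤ b := by exact_mod_cast hub
  have ha3 : (3 : ℝ) ≤ (b : ℝ) - u := by
    have h0 : u + 3 ≤ b := le_trans (by simp) hA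
    have : ((u + 3 : ℕ) : ℝ) ≤ b := by exact_mod_cast h0
    push_cast at this; linarith
  have haA : (A₀ : ℝ) ≤ (b : ℝ) - u := by
    have h0 : u + A₀ ≤ b := le_trans (by simp) hA
    have : ((u + A₀ : ℕ) : ℝ) ≤ b := by exact_mod_cast h0
    push_cast at this; linarith
  have hx0 : 0 < x := by linarith
  have hapos : 0 ≤ x * ((b : ℝ) - u) ^ (2 * j + 1) := by
    have : 0 ≤ (b : ℝ) - u := by linarith
    positivity
  rw [mul_assoc, add_mul]
  rcases le_total (2 * (u : ℝ)) b with h2u | h2u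
  · have h1 : (b : ℝ) ^ s ≤ x := hitb.pow_le hx0.le
    have hb1 : (1 : ℝ) ≤ b := hu1.trans hubR
    have h3 : (b : ℝ) ^ (s - j) ≤ x := le_trans (pow_le_pow_right₀ hb1 (by omega)) h1
    have h4 : (b : ℝ) ^ (2 * j + 1) ≤ 2 ^ (2 * j + 1) * ((b : ℝ) - u) ^ (2 * j + 1) := by
      rw [← mul_pow]
      exact pow_le_pow_left₀ (by positivity) (by linarith) _
    have h5 : (b : ℝ) ^ (s + j + 1) = (b : ℝ) ^ (s - j) * (b : ℝ) ^ (2 * j + 1) := by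
      rw [← pow_add]; congr 1; omega
    have h6 : (b : ℝ) ^ (s + j + 1) ≤ x * (2 ^ (2 * j + 1) * ((b : ℝ) - u) ^ (2 * j + 1)) := by
      rw [h5]; gcongr
    have h7 : 0 ≤ 2 ^ (s + 1) * L * (x * ((b : ℝ) - u) ^ (2 * j + 1)) := by positivity
    linarith
  obtain ⟨P, Q, hP, hQ, hlow, hupp⟩ := hPQ u b hub
  obtain ⟨n, hn1, hn2⟩ := hitu
  obtain ⟨m, hm1, hm2⟩ := hitb
  set U : ℝ := (u : ℝ) ^ s with hU
  set V : ℝ := (b : ℝ) ^ s with hV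
  set I : ℝ := V * P - U * Q with hI
  have hU0 : 0 < U := by positivity
  have hV0 : 0 < V := by have := hu1.trans hubR; positivity
  have hUV : U ≤ V := by rw [hU, hV]; gcongr
  set W : ℝ := U * (P * V * (x - n * U) - Q * U * (x - m * V)) with hW
  have hid : U * U * V * ((P * n - Q * m : ℤ) : ℝ) = x * U * I - W := by
    push_cast; rw [hW, hI]; ring
  have hWle : |W| ≤ 2 * B * (b : ℝ) ^ j * V * x := by
    have e1 : |x - n * U| ≤ n := by rw [abs_of_nonneg (by linarith)]; linarith
    have e2 : |x - m * V| ≤ m := by rw [abs_of_nonneg (by linarith)]; linarith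
    have t1 : |P * V * (x - n * U)| ≤ B * (b : ℝ) ^ j * V * n := by
      rw [abs_mul, abs_mul, abs_of_pos hV0]; gcongr
    have t2 : |Q * U * (x - m * V)| ≤ B * (b : ℝ) ^ j * U * m := by
      rw [abs_mul, abs_mul, abs_of_pos hU0]; gcongr
    rw [hW, abs_mul, abs_of_pos hU0]
    calc _ ≤ U * (B * (b : ℝ) ^ j * V * n + B * (b : ℝ) ^ j * U * m) := by
          gcongr; exact (abs_sub _ _).trans (add_le_add t1 t2)
      _ = B * (b : ℝ) ^ j * (V * (n * U) + U * (U * m)) := by ring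
      _ ≤ B * (b : ℝ) ^ j * (V * x + V * x) := by
          gcongr B * (b : ℝ) ^ j * (V * ?_ + ?_)
          · gcongr
            calc U * m ≤ V * m := by gcongr
              _ ≤ x := by linarith
      _ = _ := by ring
  have hWsmall : |W| ≤ U * U * V / 2 := by
    have e : U * U = (u : ℝ) ^ j * (u : ℝ) ^ (2 * s - j) := by
      rw [hU, ← pow_add, ← pow_add]; congr 1; omega
    have e2 : (b : ℝ) ^ j ≤ 2 ^ j * (u : ℝ) ^ j := by rw [← mul_pow]; gcongr
    calc |W| ≤ 2 * B * (b : ℝ) ^ j * V * x := hWle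
      _ ≤ 2 * B * (2 ^ j * (u : ℝ) ^ j) * V * x := by gcongr
      _ = (u : ℝ) ^ j * (4 * B * 2 ^ j * x) * V / 2 := by ring
      _ ≤ (u : ℝ) ^ j * (u : ℝ) ^ (2 * s - j) * V / 2 := by gcongr
      _ = _ := by rw [← e]
  have hWlt : |W| < x * U * I := by
    have e1 : ((b : ℝ) - u) / 3 ≤ (((b : ℝ) - u) / 3) ^ (2 * j + 1) :=
      le_self_pow₀ (by linarith) (by omega)
    have e2 : (b : ℝ) ^ j * V ≤ 2 ^ (j + s) * (u : ℝ) ^ (j + s) := by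
      rw [hV, ← pow_add, ← mul_pow]; gcongr
    have e3 : (u : ℝ) ^ (j + s) ≤ U * (u : ℝ) ^ (s - j - 1) := by
      rw [hU, ← pow_add]; exact pow_le_pow_right₀ hu1 (by omega)
    have e4 : 2 * B * 2 ^ (j + s) < L * (((b : ℝ) - u) / 3) := by
      have h0 : 3 * (2 * B * 2 ^ (j + s)) / L < (b : ℝ) - u := hA₀.trans_le haA
      rw [div_lt_iff₀ hL] at h0
      linarith
    calc |W| ≤ 2 * B * (b : ℝ) ^ j * V * x := hWle
      _ = 2 * B * ((b : ℝ) ^ j * V) * x := by ring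
      _ ≤ 2 * B * (2 ^ (j + s) * (u : ℝ) ^ (j + s)) * x := by gcongr
      _ = 2 * B * 2 ^ (j + s) * ((u : ℝ) ^ (j + s) * x) := by ring
      _ < L * (((b : ℝ) - u) / 3) * ((u : ℝ) ^ (j + s) * x) := by gcongr
      _ ≤ L * (((b : ℝ) - u) / 3) ^ (2 * j + 1) * (U * (u : ℝ) ^ (s - j - 1) * x) := by
          gcongr
      _ = x * U * (L * ((u : ℝ) ^ (s - j - 1) * (((b : ℝ) - u) / 3) ^ (2 * j + 1))) := by ring
      _ ≤ x * U * I := by gcongr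
  have hZpos : 0 < P * n - Q * m := by
    have h1 : 0 < U * U * V * ((P * n - Q * m : ℤ) : ℝ) := by
      rw [hid]; linarith [le_abs_self W]
    have := pos_of_mul_pos_right h1 (by positivity)
    exact_mod_cast this
  have hZ1 : (1 : ℝ) ≤ ((P * n - Q * m : ℤ) : ℝ) := by exact_mod_cast hZpos
  have h1 : U * U * V ≤ x * U * I - W := by
    rw [← hid]; exact le_mul_of_one_le_right (by positivity) hZ1
  have h2 : U * V ≤ 2 * x * I := by
    have : U * (U * V) ≤ U * (2 * x * I) := by linarith [neg_abs_le W]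
    exact le_of_mul_le_mul_left this hU0
  have hVle : V ≤ 2 ^ s * U := by rw [hV, hU, ← mul_pow]; gcongr
  have hb0 : (0 : ℝ) < b := by linarith
  have h3 : (b : ℝ) ^ (s - j - 1) * (b : ℝ) ^ (s + j + 1) ≤ (b : ℝ) ^ (s - j - 1) *
      (2 ^ (s + 1) * L * (x * ((b : ℝ) - u) ^ (2 * j + 1))) := by
    calc (b : ℝ) ^ (s - j - 1) * (b : ℝ) ^ (s + j + 1) = V * V := by
          rw [hV, ← pow_add, ← pow_add]; congr 1; omega
      _ ≤ 2 ^ s * U * V := by gcongr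
      _ = 2 ^ s * (U * V) := by ring
      _ ≤ 2 ^ s * (2 * x * (L * (((b : ℝ) - u) ^ (2 * j + 1) * (b : ℝ) ^ (s - j - 1)))) := by
          refine mul_le_mul_of_nonneg_left (h2.trans ?_) (by positivity)
          gcongr
      _ = _ := by ring
  have h4 := le_of_mul_le_mul_left h3 (by positivity)
  have h7 : 0 ≤ 2 ^ (2 * j + 1) * (x * ((b : ℝ) - u) ^ (2 * j + 1)) := by positivity
  linarith

theorem sum_le_of_gaps (φ w : ℕ → ℝ) (Φ : ℝ) (D : ℕ) (hw : ∀ m, 0 ≤ w m) (hΦ : 0 ≤ Φ)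
    (hanti : ∀ m n, D < m → m ≤ n → w n ≤ w m) (S : Finset ℕ) (hφ : ∀ b ∈ S, φ b ≤ Φ)
    (hgap : ∀ u ∈ S, ∀ b ∈ S, u < b → φ b ≤ ((b : ℝ) - u) * w b) (hD : ∀ b ∈ S, D < b)
    (N : ℕ) (hN : ∀ b ∈ S, b ≤ N) :
    ∑ b ∈ S, φ b ≤ Φ + ∑ m ∈ Finset.Ioc D N, w m := by
  induction S using Finset.induction_on_max generalizing N with
  | empty => simpa using add_nonneg hΦ (Finset.sum_nonneg fun m _ => hw m)
  | insert b S hb ih =>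
    have hbS : b ∉ S := fun h => (hb b h).false
    rw [Finset.sum_insert hbS]
    rcases S.eq_empty_or_nonempty with rfl | hne
    · have h1 := hφ b (by simp)
      have h2 : 0 ≤ ∑ m ∈ Finset.Ioc D N, w m := Finset.sum_nonneg fun m _ => hw m
      simpa using by linarith
    · set u := S.max' hne with hu
      have huS : u ∈ S := S.max'_mem hne
      have hub : u < b := hb u huS
      have hDu : D < u := hD u (Finset.mem_insert_of_mem huS)
      have h1 := ih (fun b hb => hφ b (Finset.mem_insert_of_mem hb))
        (fun u hu b hb => hgap u (Finset.mem_insert_of_mem hu) b (Finset.mem_insert_of_mem hb))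
        (fun b hb => hD b (Finset.mem_insert_of_mem hb)) u (fun b hb => S.le_max' b hb)
      have h2 := hgap u (Finset.mem_insert_of_mem huS) b (Finset.mem_insert_self _ _) hub
      have h3 : ((b : ℝ) - u) * w b ≤ ∑ m ∈ Finset.Ioc u b, w m := by
        have := Finset.card_nsmul_le_sum (Finset.Ioc u b) w (w b) fun m hm => by
          rw [Finset.mem_Ioc] at hm
          exact hanti m b (by omega) hm.2
        rw [Nat.card_Ioc, nsmul_eq_mul, Nat.cast_sub hub.le] at this
        exact this
      have h4 : ∑ m ∈ Finset.Ioc D u, w m + ∑ m ∈ Finset.Ioc u b, w m ≤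
          ∑ m ∈ Finset.Ioc D N, w m := by
        rw [Finset.sum_Ioc_consecutive _ hDu.le hub.le]
        refine Finset.sum_le_sum_of_subset_of_nonneg (Finset.Ioc_subset_Ioc le_rfl ?_)
          fun m _ _ => hw m
        exact hN b (Finset.mem_insert_self _ _)
      linarith

theorem sum_Ioc_rpow_le {β : ℝ} (hβ : β < -1) {D : ℕ} (hD : 1 ≤ D) (N : ℕ) :
    ∑ m ∈ Finset.Ioc D N, (m : ℝ) ^ β ≤ (D : ℝ) ^ (β + 1) / (-β - 1) := by
  have hD0 : (0 : ℝ) < D := by exact_mod_cast hD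
  rcases le_total N D with h | h
  · rw [Finset.Ioc_eq_empty (by omega), Finset.sum_empty]
    exact div_nonneg (by positivity) (by linarith)
  · have hanti : AntitoneOn (fun t : ℝ => t ^ β) (Set.Icc (D : ℝ) N) := fun a ha b _ hab =>
      Real.rpow_le_rpow_of_nonpos (hD0.trans_le ha.1) hab (by linarith)
    have h1 := hanti.sum_le_integral_Ico h
    have hN0 : (0 : ℝ) < N := hD0.trans_le (by exact_mod_cast h)
    rw [integral_rpow (Or.inr ⟨by linarith, Set.notMem_uIcc_of_lt hD0 hN0⟩)] at h1
    have h2 : ∑ m ∈ Finset.Ioc D N, (m : ℝ) ^ β =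
        ∑ i ∈ Finset.Ico D N, ((i + 1 : ℕ) : ℝ) ^ β := by
      rw [Finset.sum_Ico_add' (fun m : ℕ => (m : ℝ) ^ β) D N 1]
      refine Finset.sum_congr ?_ fun _ _ => rfl
      ext m; simp only [Finset.mem_Ioc, Finset.mem_Ico]; omega
    rw [h2]
    refine h1.trans ?_
    have h3 : ((N : ℝ) ^ (β + 1) - (D : ℝ) ^ (β + 1)) / (β + 1) =
        ((D : ℝ) ^ (β + 1) - (N : ℝ) ^ (β + 1)) / (-β - 1) := by
      rw [← neg_div_neg_eq]; congr 1 <;> ring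
    rw [h3]
    have : 0 ≤ (N : ℝ) ^ (β + 1) := by positivity
    have h4 : 0 < -β - 1 := by linarith
    gcongr
    linarith

open Classical in
theorem FloorHit.sum_rpow_le (j s : ℕ) (hs : 2 * j + 1 ≤ s) (α : ℝ) (hα0 : 0 ≤ α)
    (hα : α < ((s : ℝ) - j) / (2 * j + 1)) :
    ∃ K C : ℝ, 1 ≤ K ∧ 0 ≤ C ∧ ∀ (y : ℝ) (D N : ℕ), 1 ≤ y → K * y ≤ D →
      ∑ d ∈ Finset.Ioc D N with FloorHit s (y ^ (s + j + 1)) d, (d : ℝ) ^ α ≤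
        C * y ^ (1 + α) := by
  obtain ⟨A, K, C, hA, hK, hC, hgap⟩ := FloorHit.gap j s hs
  have ht0 : (0 : ℝ) < 2 * j + 1 := by positivity
  set t : ℝ := 2 * j + 1 with ht
  set e : ℝ := s + j + 1 with he
  set β : ℝ := α - e / t with hβdef
  have hβ : β < -1 := by
    have : ((s : ℝ) - j) / t = e / t - 1 := by field_simp; rw [he, ht]; ring
    rw [hβdef]; linarith
  have hs0 : (0 : ℝ) < s := by
    have : 0 < s := by omega
    exact_mod_cast this
  set C₁ : ℝ := C ^ (1 / t) with hC₁
  have hC₁0 : 0 ≤ C₁ := by positivity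
  have hβ0 : 0 < -β - 1 := by linarith
  refine ⟨max 1 K, A * (1 + C₁ / (-β - 1)), le_max_left _ _, by positivity,
    fun y D N hy hD => ?_⟩
  have hy0 : 0 < y := by linarith
  set x : ℝ := y ^ (s + j + 1) with hx
  have hx1 : 1 ≤ x := one_le_pow₀ hy
  have hyD : y ≤ D := le_trans (le_mul_of_one_le_left hy0.le (le_max_left _ _)) hD
  have hD1 : 1 ≤ D := by
    have : (1 : ℝ) ≤ D := hy.trans hyD
    exact_mod_cast this
  have hD0 : (0 : ℝ) < D := by exact_mod_cast hD1
  have hxe : x = y ^ e := by rw [hx, he, ← Real.rpow_natCast]; push_cast; rfl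
  have hKx : ∀ u : ℕ, D < u → K * x ≤ (u : ℝ) ^ (2 * s - j) := fun u hu => by
    have h1 : max 1 K * y ≤ u := hD.trans (by exact_mod_cast hu.le)
    calc K * x ≤ max 1 K * y ^ (2 * s - j) := by
          gcongr
          · exact le_max_right _ _
          · exact pow_le_pow_right₀ hy (by omega)
      _ ≤ (max 1 K) ^ (2 * s - j) * y ^ (2 * s - j) := by
          gcongr; exact le_self_pow₀ (le_max_left _ _) (by omega)
      _ ≤ (u : ℝ) ^ (2 * s - j) := by
          rw [← mul_pow]; gcongr
  set S := Finset.filter (fun d => FloorHit s x d) (Finset.Ioc D N) with hS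
  have hmaps : ∀ d ∈ S, d % A ∈ Finset.range A := fun d _ =>
    Finset.mem_range.2 (Nat.mod_lt _ (by omega))
  rw [← Finset.sum_fiberwise_of_maps_to hmaps]
  have hclass : ∀ c ∈ Finset.range A, ∑ d ∈ S with d % A = c, (d : ℝ) ^ α ≤
      (1 + C₁ / (-β - 1)) * y ^ (1 + α) := fun c _ => by
    have h1 := sum_le_of_gaps (fun d => (d : ℝ) ^ α) (fun m => C₁ * y ^ (e / t) * (m : ℝ) ^ β)
      (y ^ (1 + α)) D (fun m => by positivity) (by positivity) (fun m n hm hmn => by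
        have hm0 : (0 : ℝ) < m := by exact_mod_cast (by omega : 0 < m)
        have : (n : ℝ) ^ β ≤ (m : ℝ) ^ β :=
          Real.rpow_le_rpow_of_nonpos hm0 (by exact_mod_cast hmn) (by linarith)
        gcongr) (S.filter (fun d => d % A = c)) ?_ ?_ ?_ N ?_
    · rw [← Finset.mul_sum] at h1
      have h2 := sum_Ioc_rpow_le hβ hD1 N
      have h3 : (D : ℝ) ^ (β + 1) ≤ y ^ (β + 1) :=
        Real.rpow_le_rpow_of_nonpos hy0 hyD (by linarith)
      have h4 : y ^ (e / t) * y ^ (β + 1) = y ^ (1 + α) := by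
        rw [← Real.rpow_add hy0]; congr 1; rw [hβdef]; ring
      calc _ ≤ y ^ (1 + α) + C₁ * y ^ (e / t) * (y ^ (β + 1) / (-β - 1)) := by
            refine h1.trans ?_
            gcongr
            exact h2.trans (by gcongr)
        _ = y ^ (1 + α) + C₁ * (y ^ (e / t) * y ^ (β + 1)) / (-β - 1) := by ring
        _ = _ := by rw [h4]; ring
    · intro b hb
      simp only [hS, Finset.mem_filter, Finset.mem_Ioc] at hb
      have h2 : (b : ℝ) ^ s ≤ x := hb.1.2.pow_le (by linarith)
      have h3 : (b : ℝ) ^ α = ((b : ℝ) ^ s) ^ (α / s) := by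
        rw [← Real.rpow_natCast, ← Real.rpow_mul (by positivity)]; congr 1; field_simp
      calc (b : ℝ) ^ α = ((b : ℝ) ^ s) ^ (α / s) := h3
        _ ≤ x ^ (α / s) := by gcongr
        _ = y ^ (e * (α / s)) := by rw [hxe, ← Real.rpow_mul hy0.le]
        _ ≤ y ^ (1 + α) := by
          refine Real.rpow_le_rpow_of_exponent_le hy ?_
          rw [mul_div_assoc', div_le_iff₀ hs0]
          rw [lt_div_iff₀ ht0] at hα
          have hj : (0 : ℝ) ≤ j := by positivity
          have hjs : 2 * (j : ℝ) + 1 ≤ s := by exact_mod_cast hs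
          have : α * (j + 1) ≤ s := by nlinarith
          rw [he]; linarith
    · intro u hu b hb hub
      simp only [hS, Finset.mem_filter, Finset.mem_Ioc] at hu hb
      have hb0 : (0 : ℝ) < b := by exact_mod_cast (by omega : 0 < b)
      have hA' : u + A ≤ b := by
        have h2 : A ∣ b - u := (Nat.modEq_iff_dvd' hub.le).1 (hu.2.trans hb.2.symm)
        have := Nat.le_of_dvd (by omega) h2
        omega
      have hba : 0 ≤ (b : ℝ) - u := by
        have : (u : ℝ) ≤ b := by exact_mod_cast hub.le
        linarith
      have h2 := hgap x u b hx1 (by omega) hu.1.2 hb.1.2 (hKx u hu.1.1.1) hA'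
      have h3 := Real.rpow_le_rpow (by positivity) h2 (by positivity : 0 ≤ 1 / t)
      have h4 : ((b : ℝ) ^ (s + j + 1)) ^ (1 / t) = (b : ℝ) ^ (e / t) := by
        rw [← Real.rpow_natCast, ← Real.rpow_mul hb0.le, he]; congr 1; push_cast; ring
      have h5 : (C * x * ((b : ℝ) - u) ^ (2 * j + 1)) ^ (1 / t) =
          C₁ * y ^ (e / t) * ((b : ℝ) - u) := by
        rw [Real.mul_rpow (by positivity) (by positivity),
          Real.mul_rpow hC.le (by positivity), hxe, ← Real.rpow_mul hy0.le,
          ← Real.rpow_natCast ((b : ℝ) - u), ← Real.rpow_mul hba]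
        have : ((2 * j + 1 : ℕ) : ℝ) * (1 / t) = 1 := by
          rw [ht]; push_cast; field_simp
        rw [this, Real.rpow_one, mul_one_div]
      rw [h4, h5] at h3
      calc (b : ℝ) ^ α = (b : ℝ) ^ (e / t) * (b : ℝ) ^ β := by
            rw [← Real.rpow_add hb0]; congr 1; rw [hβdef]; ring
        _ ≤ C₁ * y ^ (e / t) * ((b : ℝ) - u) * (b : ℝ) ^ β := by gcongr
        _ = _ := by ring
    · intro b hb
      simp only [hS, Finset.mem_filter, Finset.mem_Ioc] at hb
      exact hb.1.1.1
    · intro b hb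
      simp only [hS, Finset.mem_filter, Finset.mem_Ioc] at hb
      exact hb.1.1.2
  refine (Finset.sum_le_sum hclass).trans (le_of_eq ?_)
  rw [Finset.sum_const, Finset.card_range, nsmul_eq_mul]
  ring

/-- The number of `n ≤ x` with `⌊x / n⌋ = q`. -/
noncomputable def floorCount (x : ℝ) (q : ℕ) : ℕ :=
  ((Finset.Icc 1 ⌊x⌋₊).filter fun n : ℕ => ⌊x / (n : ℝ)⌋₊ = q).card

theorem floor_div_eq_iff {x : ℝ} (hx : 0 ≤ x) {n q : ℕ} (hn : 1 ≤ n) :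
    ⌊x / (n : ℝ)⌋₊ = q ↔ (n : ℝ) * q ≤ x ∧ x < n * ((q : ℝ) + 1) := by
  have hn0 : (0 : ℝ) < n := by exact_mod_cast hn
  rw [Nat.floor_eq_iff (by positivity), le_div_iff₀ hn0, div_lt_iff₀ hn0, mul_comm (q : ℝ),
    mul_comm ((q : ℝ) + 1)]

theorem floorCount_eq {x : ℝ} (hx : 0 ≤ x) {q : ℕ} (hq : 1 ≤ q) :
    floorCount x q = ⌊x / (q : ℝ)⌋₊ - ⌊x / ((q : ℝ) + 1)⌋₊ := by
  have hq0 : (0 : ℝ) < q := by exact_mod_cast hq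
  rw [floorCount, ← Nat.card_Ioc]
  congr 1
  ext n
  simp only [Finset.mem_filter, Finset.mem_Icc, Finset.mem_Ioc]
  rw [Nat.floor_lt (by positivity), Nat.le_floor_iff (a := x / (q : ℝ)) (by positivity),
    div_lt_iff₀ (by positivity),
    le_div_iff₀ hq0]
  constructor
  · rintro ⟨⟨h1, _⟩, h3⟩
    exact ((floor_div_eq_iff hx h1).1 h3).symm
  · rintro ⟨h1, h2⟩
    have hn : 1 ≤ n := by
      rcases Nat.eq_zero_or_pos n with rfl | h
      · simp at h1; linarith
      · exact h
    refine ⟨⟨hn, Nat.le_floor ?_⟩, (floor_div_eq_iff hx hn).2 ⟨h2, h1⟩⟩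
    have : (1 : ℝ) ≤ q := by exact_mod_cast hq
    exact le_trans (le_mul_of_one_le_right (by positivity) this) h2

theorem abs_floorCount_sub_le {x : ℝ} (hx : 0 ≤ x) {q : ℕ} (hq : 1 ≤ q) :
    |(floorCount x q : ℝ) - x / ((q : ℝ) * (q + 1))| ≤ 1 := by
  have hq0 : (0 : ℝ) < q := by exact_mod_cast hq
  have hle : x / ((q : ℝ) + 1) ≤ x / q := by gcongr; linarith
  rw [floorCount_eq hx hq, Nat.cast_sub (Nat.floor_mono hle)]
  have e : x / ((q : ℝ) * (q + 1)) = x / q - x / (q + 1) := by field_simp; ring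
  have h1 := Nat.floor_le (by positivity : 0 ≤ x / (q : ℝ))
  have h2 := Nat.floor_le (by positivity : 0 ≤ x / ((q : ℝ) + 1))
  have h3 := Nat.lt_floor_add_one (x / (q : ℝ))
  have h4 := Nat.lt_floor_add_one (x / ((q : ℝ) + 1))
  rw [e, abs_le]
  constructor <;> linarith

theorem floorCount_le_one {x : ℝ} (hx : 0 ≤ x) {q : ℕ} (hq : 1 ≤ q)
    (hxq : x < (q : ℝ) * (q + 1)) : floorCount x q ≤ 1 := by
  have h1 := (abs_le.1 (abs_floorCount_sub_le hx hq)).2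
  have hq0 : (0 : ℝ) < q := by exact_mod_cast hq
  have h2 : x / ((q : ℝ) * (q + 1)) < 1 := by rwa [div_lt_one (by positivity)]
  have h3 : (floorCount x q : ℝ) < 2 := by linarith
  have : floorCount x q < 2 := by exact_mod_cast h3
  omega

theorem floorHit_of_floorCount_pos {x : ℝ} (hx : 0 ≤ x) {s d : ℕ}
    (h : 0 < floorCount x (d ^ s)) : FloorHit s x d := by
  obtain ⟨n, hn⟩ := Finset.card_pos.1 h
  simp only [Finset.mem_filter, Finset.mem_Icc] at hn
  have := (floor_div_eq_iff hx hn.1.1).1 hn.2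
  push_cast at this
  exact ⟨n, this⟩

theorem SupportedOnPowers.floorSum_eq {r : ℕ} {h f : ℕ → ℂ} (hf : SupportedOnPowers r h f)
    (hr : 1 ≤ r) {x : ℝ} (hx : 0 ≤ x) {Y : ℕ} (hY : ⌊x⌋₊ ≤ Y) :
    floorSum f x = ∑ d ∈ Finset.Icc 1 Y, (floorCount x (d ^ r) : ℂ) * h d := by
  have h1 : ∀ n ∈ Finset.Icc 1 ⌊x⌋₊, f ⌊x / (n : ℝ)⌋₊ =
      ∑ d ∈ Finset.Icc 1 Y, if ⌊x / (n : ℝ)⌋₊ = d ^ r then h d else 0 := by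
    intro n hn
    rw [Finset.mem_Icc] at hn
    have hn0 : (0 : ℝ) < n := by exact_mod_cast hn.1
    have hm1 : 1 ≤ ⌊x / (n : ℝ)⌋₊ := by
      rw [Nat.one_le_floor_iff, one_le_div hn0]
      exact (Nat.le_floor_iff hx).1 hn.2
    by_cases hd : ∃ d : ℕ, ⌊x / (n : ℝ)⌋₊ = d ^ r
    · obtain ⟨d, hd⟩ := hd
      have hd1 : 1 ≤ d := by
        rcases Nat.eq_zero_or_pos d with rfl | h'
        · rw [zero_pow (by omega)] at hd; omega
        · exact h'
      have hdY : d ≤ Y := by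
        calc d ≤ d ^ r := Nat.le_self_pow (by omega) d
          _ = ⌊x / (n : ℝ)⌋₊ := hd.symm
          _ ≤ ⌊x⌋₊ := Nat.floor_mono (div_le_self hx (by exact_mod_cast hn.1))
          _ ≤ Y := hY
      rw [Finset.sum_eq_single d, if_pos hd, hd, hf.1 d hd1]
      · intro b _ hbd
        rw [if_neg]
        intro hb
        exact hbd (Nat.pow_left_injective (by omega : r ≠ 0) (hb.symm.trans hd))
      · intro hd'
        exact absurd (Finset.mem_Icc.2 ⟨hd1, hdY⟩) hd'
    · push Not at hd
      rw [hf.2 _ hm1 hd]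
      exact (Finset.sum_eq_zero fun d _ => if_neg (hd d)).symm
  rw [floorSum, Finset.sum_congr rfl h1, Finset.sum_comm]
  refine Finset.sum_congr rfl fun d _ => ?_
  rw [← Finset.sum_filter, Finset.sum_const, nsmul_eq_mul, floorCount]

theorem SupportedOnPowers.hasSum_mainTerm_iff {r : ℕ} {h f : ℕ → ℂ}
    (hf : SupportedOnPowers r h f) (hr : 1 ≤ r) (c : ℂ) :
    HasSum (fun k : ℕ => h (k + 1) / (((k + 1 : ℕ) : ℂ) ^ r * (((k + 1 : ℕ) : ℂ) ^ r + 1))) c ↔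
      HasSum (mainTerm f) c := by
  have hpos : ∀ k : ℕ, 1 ≤ (k + 1) ^ r := fun k => Nat.one_le_pow _ _ (by omega)
  have hinj : Function.Injective fun k : ℕ => (k + 1) ^ r - 1 := fun a b hab => by
    have h1 : (a + 1) ^ r = (b + 1) ^ r := by
      have := hpos a; have := hpos b; simp only at hab; omega
    have := Nat.pow_left_injective (by omega : r ≠ 0) h1
    omega
  refine Iff.trans ?_ (hinj.hasSum_iff (f := mainTerm f) ?_)
  · refine iff_of_eq (congrArg (fun g => HasSum g c) (funext fun k => ?_))
    have h1 : (k + 1) ^ r - 1 + 1 = (k + 1) ^ r := Nat.sub_add_cancel (hpos k)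
    have h2 : (((k + 1) ^ r - 1 : ℕ) : ℂ) + 1 = ((k + 1 : ℕ) : ℂ) ^ r := by
      exact_mod_cast congrArg (Nat.cast : ℕ → ℂ) h1
    have h3 : (((k + 1) ^ r - 1 : ℕ) : ℂ) + 2 = ((k + 1 : ℕ) : ℂ) ^ r + 1 := by
      rw [← h2]; ring
    simp only [Function.comp, mainTerm]
    rw [h1, h2, h3, hf.1 (k + 1) (by omega)]
  · intro n hn
    rw [mainTerm, hf.2 (n + 1) (by omega), zero_div]
    intro d hd
    have hd1 : 1 ≤ d := by
      rcases Nat.eq_zero_or_pos d with rfl | h'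
      · rw [zero_pow (by omega)] at hd; omega
      · exact h'
    refine hn ⟨d - 1, ?_⟩
    simp only
    rw [Nat.sub_add_cancel hd1, ← hd, Nat.add_sub_cancel]

theorem exists_norm_le_rpow {h : ℕ → ℂ} {α : ℝ}
    (hh : h =O[atTop] fun d : ℕ => (d : ℝ) ^ α) :
    ∃ H : ℝ, 0 ≤ H ∧ ∀ d : ℕ, 1 ≤ d → ‖h d‖ ≤ H * (d : ℝ) ^ α := by
  obtain ⟨H, hH0, hH⟩ := bound_of_isBigO_nat_atTop hh
  refine ⟨H, hH0.le, fun d hd => ?_⟩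
  have hd0 : (0 : ℝ) < d := by exact_mod_cast hd
  have h0 : 0 < (d : ℝ) ^ α := by positivity
  simpa [abs_of_pos h0] using hH h0.ne'

theorem norm_div_pow_le {z : ℂ} {H α : ℝ} {d s : ℕ} (hd : 1 ≤ d)
    (hz : ‖z‖ ≤ H * (d : ℝ) ^ α) :
    ‖z / ((d : ℂ) ^ s * ((d : ℂ) ^ s + 1))‖ ≤ H * (d : ℝ) ^ (α - 2 * s) := by
  have hd0 : (0 : ℝ) < d := by exact_mod_cast hd
  have e : ‖(d : ℂ) ^ s * ((d : ℂ) ^ s + 1)‖ = (d : ℝ) ^ s * ((d : ℝ) ^ s + 1) := by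
    have : (d : ℂ) ^ s * ((d : ℂ) ^ s + 1) = ((d ^ s * (d ^ s + 1) : ℕ) : ℂ) := by push_cast; ring
    rw [this, Complex.norm_natCast]; push_cast; ring
  have e2 : (d : ℝ) ^ (α - 2 * s) = (d : ℝ) ^ α / ((d : ℝ) ^ s * (d : ℝ) ^ s) := by
    rw [Real.rpow_sub hd0]; congr 1
    rw [← pow_add, ← Real.rpow_natCast]; congr 1; push_cast; ring
  rw [norm_div, e, e2, mul_div_assoc']
  have : 0 ≤ H * (d : ℝ) ^ α := (norm_nonneg z).trans hz
  gcongr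
  linarith

open Classical in
theorem norm_floorSum_sub_le (j s : ℕ) (hs : 2 * j + 1 ≤ s) (α : ℝ) (hα0 : 0 ≤ α)
    (hα : α < ((s : ℝ) - j) / (2 * j + 1)) (h f : ℕ → ℂ) (hf : SupportedOnPowers s h f)
    (hh : h =O[atTop] fun d : ℕ => (d : ℝ) ^ α) :
    Summable (mainTerm f) ∧ ∃ C : ℝ, ∀ y : ℝ, 1 ≤ y →
      ‖floorSum f (y ^ (s + j + 1)) - mainConst f * ((y ^ (s + j + 1) : ℝ) : ℂ)‖ ≤
        C * y ^ (1 + α) := by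
  obtain ⟨H, hH0, hH⟩ := exists_norm_le_rpow hh
  have hs1 : 1 ≤ s := by omega
  set G : ℕ → ℂ := fun d => h d / ((d : ℂ) ^ s * ((d : ℂ) ^ s + 1)) with hG
  have hGle : ∀ d : ℕ, 1 ≤ d → ‖G d‖ ≤ H * (d : ℝ) ^ (α - 2 * s) := fun d hd =>
    norm_div_pow_le hd (hH d hd)
  have hβ : α - 2 * s < -1 := by
    rw [lt_div_iff₀ (by positivity)] at hα
    have hj : (0 : ℝ) ≤ j := by positivity
    have hs' : (1 : ℝ) ≤ s := by exact_mod_cast hs1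
    nlinarith
  have hsum : Summable fun k : ℕ => ‖G (k + 1)‖ := by
    refine Summable.of_nonneg_of_le (fun _ => norm_nonneg _) (fun k => hGle (k + 1) (by omega)) ?_
    exact ((summable_nat_add_iff 1).2 (Real.summable_nat_rpow.2 hβ)).mul_left H
  have hsumG : Summable fun k : ℕ => G (k + 1) := hsum.of_norm
  have hHas : HasSum (mainTerm f) (∑' k, G (k + 1)) :=
    (hf.hasSum_mainTerm_iff hs1 _).1 hsumG.hasSum
  obtain ⟨K, C, hK, hC, hhit⟩ := FloorHit.sum_rpow_le j s hs α hα0 hα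
  set γ : ℝ := -(α - 2 * s) - 1 with hγ
  have hγ0 : 0 < γ := by linarith
  refine ⟨hHas.summable, H * (K + 1) ^ (1 + α) + H * C + H / γ, fun y hy => ?_⟩
  have hy0 : 0 < y := by linarith
  set x : ℝ := y ^ (s + j + 1) with hx
  have hx0 : 0 < x := by positivity
  set D : ℕ := ⌈K * y⌉₊ with hDdef
  have hKD : K * y ≤ D := Nat.le_ceil _
  have hDle : (D : ℝ) ≤ (K + 1) * y := by
    have := Nat.ceil_lt_add_one (by positivity : 0 ≤ K * y)
    linarith
  have hyD : y ≤ D := le_trans (le_mul_of_one_le_left hy0.le hK) hKD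
  have hD0 : (0 : ℝ) < D := by linarith
  have hD1 : 1 ≤ D := by exact_mod_cast hD0
  set Y : ℕ := D + ⌊x⌋₊ with hY
  have hsplit : ∀ F : ℕ → ℂ, ∑ d ∈ Finset.Icc 1 Y, F d =
      ∑ d ∈ Finset.Ioc 0 D, F d + ∑ d ∈ Finset.Ioc D Y, F d := fun F => by
    rw [Finset.sum_Ioc_consecutive _ (by omega) (by omega)]
    rfl
  have hconst : mainConst f = ∑ d ∈ Finset.Ioc 0 D, G d + ∑' k, G (k + D + 1) := by
    rw [mainConst, hHas.tsum_eq, ← hsumG.sum_add_tsum_nat_add D, Finset.range_eq_Ico,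
      Finset.sum_Ico_add' G 0 D 1]
    rfl
  have htail : ‖∑' k, G (k + D + 1)‖ ≤ H * ((D : ℝ) ^ (α - 2 * s + 1) / γ) := by
    have hsD : Summable fun k => ‖G (k + D + 1)‖ :=
      (summable_nat_add_iff (f := fun k => ‖G (k + 1)‖) D).2 hsum
    refine (norm_tsum_le_tsum_norm hsD).trans ?_
    refine Real.tsum_le_of_sum_range_le (fun _ => norm_nonneg _) fun n => ?_
    calc ∑ k ∈ Finset.range n, ‖G (k + D + 1)‖
        ≤ ∑ k ∈ Finset.range n, H * ((k + (D + 1) : ℕ) : ℝ) ^ (α - 2 * s) :=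
          Finset.sum_le_sum fun k _ => hGle (k + D + 1) (by omega)
      _ = H * ∑ m ∈ Finset.Ioc D (D + n), (m : ℝ) ^ (α - 2 * s) := by
          rw [← Finset.mul_sum, Finset.range_eq_Ico,
            Finset.sum_Ico_add' (fun m : ℕ => (m : ℝ) ^ (α - 2 * s)) 0 n (D + 1)]
          congr 1
          refine Finset.sum_congr ?_ fun _ _ => rfl
          ext m; simp only [Finset.mem_Ioc, Finset.mem_Ico]; omega
      _ ≤ _ := by
          gcongr
          exact sum_Ioc_rpow_le hβ hD1 _
  have hdecomp : floorSum f x - mainConst f * (x : ℂ) =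
      ∑ d ∈ Finset.Ioc 0 D, (((floorCount x (d ^ s) : ℝ) -
        x / ((d ^ s : ℕ) * ((d ^ s : ℕ) + 1)) : ℝ) : ℂ) * h d +
      ∑ d ∈ Finset.Ioc D Y, (floorCount x (d ^ s) : ℂ) * h d -
      (∑' k, G (k + D + 1)) * (x : ℂ) := by
    rw [hf.floorSum_eq hs1 hx0.le (by omega : ⌊x⌋₊ ≤ Y), hsplit, hconst, add_mul, Finset.sum_mul,
      ← sub_sub, add_sub_right_comm, ← Finset.sum_sub_distrib]
    congr 2
    refine Finset.sum_congr rfl fun d _ => ?_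
    simp only [hG]
    push_cast
    ring
  have hA : ‖∑ d ∈ Finset.Ioc 0 D, (((floorCount x (d ^ s) : ℝ) -
        x / ((d ^ s : ℕ) * ((d ^ s : ℕ) + 1)) : ℝ) : ℂ) * h d‖ ≤
      H * (K + 1) ^ (1 + α) * y ^ (1 + α) := by
    calc _ ≤ ∑ d ∈ Finset.Ioc 0 D, H * (D : ℝ) ^ α := by
          refine norm_sum_le_of_le _ fun d hd => ?_
          rw [Finset.mem_Ioc] at hd
          have hdD : (d : ℝ) ≤ D := by exact_mod_cast hd.2
          rw [norm_mul, Complex.norm_real, Real.norm_eq_abs]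
          have h1 := abs_floorCount_sub_le hx0.le (Nat.one_le_pow s d hd.1)
          calc _ ≤ 1 * ‖h d‖ := by gcongr
            _ = ‖h d‖ := one_mul _
            _ ≤ H * (d : ℝ) ^ α := hH d hd.1
            _ ≤ H * (D : ℝ) ^ α := by gcongr
      _ = H * (D : ℝ) ^ (1 + α) := by
          rw [Finset.sum_const, Nat.card_Ioc, nsmul_eq_mul, Real.rpow_add hD0, Real.rpow_one,
            Nat.sub_zero]
          ring
      _ ≤ H * ((K + 1) * y) ^ (1 + α) := by gcongr
      _ = _ := by rw [Real.mul_rpow (by linarith) hy0.le, mul_assoc]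
  have hB : ‖∑ d ∈ Finset.Ioc D Y, (floorCount x (d ^ s) : ℂ) * h d‖ ≤
      H * C * y ^ (1 + α) := by
    calc _ ≤ ∑ d ∈ Finset.Ioc D Y, if FloorHit s x d then H * (d : ℝ) ^ α else 0 := by
          refine norm_sum_le_of_le _ fun d hd => ?_
          rw [Finset.mem_Ioc] at hd
          have hd1 : 1 ≤ d := by omega
          rw [norm_mul, Complex.norm_natCast]
          split_ifs with hit
          · have hyd : y ≤ d := hyD.trans (by exact_mod_cast hd.1.le)
            have hxd : x < ((d ^ s : ℕ) : ℝ) * ((d ^ s : ℕ) + 1) := by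
              have h1 : (1 : ℝ) ≤ (d : ℝ) := hy.trans hyd
              calc x ≤ y ^ (s + s) := pow_le_pow_right₀ hy (by omega)
                _ ≤ (d : ℝ) ^ (s + s) := by gcongr
                _ = (d : ℝ) ^ s * (d : ℝ) ^ s := pow_add _ _ _
                _ < (d : ℝ) ^ s * ((d : ℝ) ^ s + 1) := by
                  have : 0 < (d : ℝ) ^ s := by positivity
                  nlinarith
                _ = _ := by push_cast; ring
            have h1 : (floorCount x (d ^ s) : ℝ) ≤ 1 := by
              exact_mod_cast floorCount_le_one hx0.le (Nat.one_le_pow s d hd1) hxd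
            calc _ ≤ 1 * ‖h d‖ := by gcongr
              _ = ‖h d‖ := one_mul _
              _ ≤ _ := hH d hd1
          · have : floorCount x (d ^ s) = 0 := by
              by_contra h0
              exact hit (floorHit_of_floorCount_pos hx0.le (Nat.pos_of_ne_zero h0))
            rw [this]; simp
      _ = H * ∑ d ∈ Finset.Ioc D Y with FloorHit s x d, (d : ℝ) ^ α := by
          rw [← Finset.sum_filter, Finset.mul_sum]
      _ ≤ H * (C * y ^ (1 + α)) := by gcongr; exact hhit y D Y hy hKD
      _ = _ := by ring
  have hT : ‖(∑' k, G (k + D + 1)) * (x : ℂ)‖ ≤ H / γ * y ^ (1 + α) := by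
    rw [norm_mul, Complex.norm_real, Real.norm_eq_abs, abs_of_pos hx0]
    have h1 : (D : ℝ) ^ (α - 2 * s + 1) ≤ y ^ (α - 2 * s + 1) :=
      Real.rpow_le_rpow_of_nonpos hy0 hyD (by linarith)
    have h2 : y ^ (α - 2 * s + 1) * x ≤ y ^ (1 + α) := by
      rw [hx, ← Real.rpow_natCast, ← Real.rpow_add hy0]
      refine Real.rpow_le_rpow_of_exponent_le hy ?_
      have : ((s + j + 1 : ℕ) : ℝ) ≤ 2 * s := by exact_mod_cast (by omega : s + j + 1 ≤ 2 * s)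
      linarith
    calc _ ≤ H * ((D : ℝ) ^ (α - 2 * s + 1) / γ) * x := by gcongr
      _ ≤ H * (y ^ (α - 2 * s + 1) / γ) * x := by gcongr
      _ = H / γ * (y ^ (α - 2 * s + 1) * x) := by ring
      _ ≤ _ := by gcongr
  rw [hdecomp]
  calc _ ≤ _ := (norm_sub_le _ _).trans (add_le_add (norm_add_le _ _) le_rfl)
    _ ≤ _ := add_le_add (add_le_add hA hB) hT
    _ = _ := by ring

theorem theorem1 (r : ℕ) (hr : 1 ≤ r) (α : ℝ) (hα0 : 0 ≤ α)
    (hα : α < ((r : ℝ) + 2 - parityEta r) / (2 * (r : ℝ) - 2 + 2 * parityEta r))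
    (h f : ℕ → ℂ) (hf : SupportedOnPowers r h f)
    (hh : h =O[atTop] fun d : ℕ => (d : ℝ) ^ α) :
    Summable (mainTerm f) ∧
      ∃ C : ℝ, ∀ x : ℝ, 1 ≤ x →
        ‖floorSum f x - mainConst f * (x : ℂ)‖ ≤
          C * x ^ (2 * (1 + α) / (3 * (r : ℝ) + parityEta r)) := by
  obtain ⟨j, hjr, hj⟩ : ∃ j : ℕ, 2 * j + 1 ≤ r ∧ 2 * (j : ℝ) = r - 2 + parityEta r := by
    rcases Nat.even_or_odd r with he | ho
    · have hne : ¬ Odd r := Nat.not_odd_iff_even.2 he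
      obtain ⟨k, rfl⟩ := he
      refine ⟨k - 1, by omega, ?_⟩
      rw [parityEta, if_neg hne, Nat.cast_sub (by omega)]
      push_cast; ring
    · have ho' := ho
      obtain ⟨k, rfl⟩ := ho
      refine ⟨k, le_rfl, ?_⟩
      rw [parityEta, if_pos ho']
      push_cast; ring
  have hη : parityEta r = 2 * j + 2 - r := by linarith
  have hα' : α < ((r : ℝ) - j) / (2 * j + 1) := by
    refine hα.trans_eq ?_
    rw [hη, show (r : ℝ) + 2 - (2 * j + 2 - r) = 2 * (r - j) by ring,
      show 2 * (r : ℝ) - 2 + 2 * (2 * j + 2 - r) = 2 * (2 * j + 1) by ring,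
      mul_div_mul_left _ _ two_ne_zero]
  obtain ⟨hS, C, hC⟩ := norm_floorSum_sub_le j r hjr α hα0 hα' h f hf hh
  refine ⟨hS, C, fun x hx => ?_⟩
  have hx0 : 0 ≤ x := by linarith
  have h1 := hC (x ^ (1 / ((r + j + 1 : ℕ) : ℝ))) (Real.one_le_rpow hx (by positivity))
  have h2 : (x ^ (1 / ((r + j + 1 : ℕ) : ℝ))) ^ (r + j + 1) = x := by
    rw [one_div]; exact Real.rpow_inv_natCast_pow hx0 (by omega)
  have h3 : 1 / ((r + j + 1 : ℕ) : ℝ) * (1 + α) =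
      2 * (1 + α) / (3 * (r : ℝ) + parityEta r) := by
    rw [hη, show 3 * (r : ℝ) + (2 * j + 2 - r) = 2 * ((r + j + 1 : ℕ) : ℝ) by push_cast; ring,
      mul_div_mul_left _ _ two_ne_zero]
    ring
  rwa [h2, ← Real.rpow_mul hx0, h3] at h1
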